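/- Let $\eta\in\mathbb R$, $P_N>0$ and $P>0$. Consider the memoryless regular perturbative channel with complex input $x$ and complex output $$y = x + j\eta|x|^2x + n,$$ where $n\sim\mathcal{CN}(0,P_N)$ (circularly symmetric complex Gaussian of mean zero and variance $P_N$) is independent of $x$. Let its capacity be $\mathcal C=\sup I(x;y)$, where the mutual information is measured in bits and the supremum is over all probability distributions of $x$ on $\mathbb C$ with $\mathbb E|x|^2\le P$. Then $$\mathcal C\;\ge\;\max_{\lambda}\ \log_2\!\left(\frac{\lambda^2+6\eta^2}{\lambda^3P_N}\,e^{\frac{12\eta^2}{\lambda^2+6\eta^2}}+1\right),$$ where the maximum, which exists, is over all $\lambda>0$ that satisfy $$\frac{18\eta^2+\lambda^2}{\lambda\,(6\eta^2+\lambda^2)}\le P.$$ The maximum is attained at exactly one $\lambda$, namely at the unique positive real root of $$P\lambda^3-\lambda^2+6P\eta^2\lambda-18\eta^2=0;$$ if $\eta\ne0$, this is the only real root of the equation. -/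

import Mathlib

open MeasureTheory ProbabilityTheory

open scoped ENNReal NNReal

namespace RPC

/-- The circularly symmetric complex Gaussian law of mean zero and variance `v`: real and imaginary
parts are independent real Gaussians of mean zero and variance `v / 2`. -/
noncomputable def complexGaussian (v : ℝ) : Measure ℂ :=
  ((gaussianReal 0 (Real.toNNReal (v / 2))).prod (gaussianReal 0 (Real.toNNReal (v / 2)))).map
    (fun p : ℝ × ℝ => (p.1 : ℂ) + (p.2 : ℂ) * Complex.I)

/-- The mutual information, in bits, of two random variables with joint law `ρ`: the relative
entropy of the joint law with respect to the product of its marginals. -/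
noncomputable def mutualInfo {α β : Type*} [MeasurableSpace α] [MeasurableSpace β]
    (ρ : Measure (α × β)) : ℝ≥0∞ :=
  InformationTheory.klDiv ρ (ρ.fst.prod ρ.snd) / ENNReal.ofReal (Real.log 2)

/-- The noiseless output `x + j η |x|² x` of the regular perturbative channel. -/
noncomputable def noiseless (η : ℝ) (x : ℂ) : ℂ :=
  x + Complex.I * (η : ℂ) * ((‖x‖ ^ 2 : ℝ) : ℂ) * x

/-- The joint law of the input `x` and the output `y = x + j η |x|² x + n`, when `x` has law `μ`
and the noise `n` is independent of `x` and circularly symmetric Gaussian of variance `P_N`. -/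
noncomputable def jointLaw (η P_N : ℝ) (μ : Measure ℂ) : Measure (ℂ × ℂ) :=
  (μ.prod (complexGaussian P_N)).map (fun p : ℂ × ℂ => (p.1, noiseless η p.1 + p.2))

/-- The capacity, in bits per channel use: the supremum of the mutual information of input and
output over all input laws with second moment at most `P`. -/
noncomputable def capacity (η P_N P : ℝ) : ℝ≥0∞ :=
  ⨆ (μ : Measure ℂ) (_ : IsProbabilityMeasure μ)
    (_ : ∫⁻ x, ‖x‖ₑ ^ 2 ∂μ ≤ ENNReal.ofReal P), mutualInfo (jointLaw η P_N μ)

/-- The function of the parameter `l` that is maximized in the lower bound. -/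
noncomputable def objective (η P_N l : ℝ) : ℝ :=
  Real.logb 2 ((l ^ 2 + 6 * η ^ 2) / (l ^ 3 * P_N)
    * Real.exp (12 * η ^ 2 / (l ^ 2 + 6 * η ^ 2)) + 1)

/-- The positive parameters that satisfy the power constraint. -/
def feasible (η P : ℝ) : Set ℝ :=
  {l | 0 < l ∧ (18 * η ^ 2 + l ^ 2) / (l * (6 * η ^ 2 + l ^ 2)) ≤ P}

/-- The cubic polynomial whose root is the optimal parameter. -/
def cubic (η P l : ℝ) : ℝ :=
  P * l ^ 3 - l ^ 2 + 6 * P * η ^ 2 * l - 18 * η ^ 2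

end RPC

namespace RPC

-- Write `w` for the noiseless output, `t = |x|²` and `κ = λ³/(λ² + 6η²)`. Since `|w|² = t + η²t³`,
-- a circularly symmetric input for which `t` has density `κ(1 + 3η²t²)e^{-λt}` gives `w` the
-- density `(κ/π)e^{-λt}`. Then `E t` is the left side of the power constraint, and the entropy of
-- `w` is `log(πeM)`, where `log M = λ E t - 1 - log κ`. The entropy power inequality gives `h(w +
-- n) ≥ log(πe(M + P_N))`; subtracting `h(n) = log(πe P_N)` leaves `log(1 + M/P_N)`, the stated
-- bound.
--
-- The instance of the entropy power inequality that is needed, `integral_log_add_le`, is proved by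
-- transport. Write `w = T(A)` and `n = σB` with `A`, `B` independent standard Gaussians and `T`
-- radial, and rotate: `A = ca - sb`, `B = sa + cb`. For fixed `b` the map from `a` to `T(A) + σB`
-- is injective, so the output density pulled back along it has mass at most one. Comparing it with
-- the Gaussian density of `a` by `log U ≤ U - 1`, and bounding the log-Jacobian below by concavity
-- of `log`, gives the inequality for all weights `c² + s² = 1`; the weights proportional to `M` and
-- `P_N` give the sharp form (`weighted_log_eq`).
--
-- For the maximization, the objective strictly decreases (`objective_lt`) and the cubic stays
-- positive beyond any point where it is nonnegative (`cubic_pos_of_lt`), so the smallest feasible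
-- parameter, the positive root, is optimal.

-- The cubic and the monotonicity of the objective

lemma mem_feasible_iff {η P l : ℝ} (hl : 0 < l) : l ∈ feasible η P ↔ 0 ≤ cubic η P l := by
  have h : 0 < l * (6 * η ^ 2 + l ^ 2) := by positivity
  simp only [feasible, cubic, Set.mem_ofPred_eq, hl, true_and, div_le_iff₀ h]
  constructor <;> intro h <;> linarith

/-- The cubic, divided by `l * (6 η² + l²)`, is increasing in `l`. -/
lemma cubic_pos_of_lt {η P l m : ℝ} (hl : 0 < l) (hlm : l < m) (h : 0 ≤ cubic η P l) :
    0 < cubic η P m := by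
  have hm : 0 < m := hl.trans hlm
  have key : (m * (6 * η ^ 2 + m ^ 2)) * cubic η P l < (l * (6 * η ^ 2 + l ^ 2)) * cubic η P m := by
    have : (l * (6 * η ^ 2 + l ^ 2)) * cubic η P m - (m * (6 * η ^ 2 + m ^ 2)) * cubic η P l
      = (m - l) * (l ^ 2 * m ^ 2 + 6 * η ^ 2 * (3 * (m ^ 2 + m * l + l ^ 2) - m * l + 18 * η ^ 2))
      := by
      unfold cubic; ring
    have h2 : 0 < (m - l) * (l ^ 2 * m ^ 2
        + 6 * η ^ 2 * (3 * (m ^ 2 + m * l + l ^ 2) - m * l + 18 * η ^ 2)) := by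
      apply mul_pos (by linarith)
      have : 0 < l * m := by positivity
      have : 0 ≤ 3 * (m ^ 2 + m * l + l ^ 2) - m * l + 18 * η ^ 2 := by nlinarith [sq_nonneg η]
      positivity
    linarith
  have h1 : 0 ≤ (m * (6 * η ^ 2 + m ^ 2)) * cubic η P l := by positivity
  have h2 := h1.trans_lt key
  exact pos_of_mul_pos_right h2 (by positivity)

lemma exists_pos_root_cubic (η : ℝ) {P : ℝ} (hP : 0 < P) : ∃ l, 0 < l ∧ cubic η P l = 0 := by
  -- For `η = 0` the cubic vanishes at `0`, which the intermediate value theorem might return.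
  by_cases hη : η = 0
  · refine ⟨P⁻¹, by positivity, ?_⟩
    simp only [cubic, hη]
    field_simp
    ring
  have hη2 : 0 < η ^ 2 := by positivity
  have h0 : cubic η P 0 < 0 := by simp only [cubic]; linarith
  -- `m = 4/P` makes both `P m - 1` and `P m - 3` positive in the factorization below.
  set m := P⁻¹ + 3 / P with hm
  have hm1 : P * m = 4 := by rw [hm]; field_simp; norm_num
  have hm0 : 0 < m := by positivity
  have h1 : 0 ≤ cubic η P m := by
    have : cubic η P m = (P * m - 1) * m ^ 2 + 6 * η ^ 2 * (P * m - 3) := by unfold cubic; ring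
    rw [this, hm1]; positivity
  have hc : ContinuousOn (cubic η P) (Set.Icc 0 m) := by unfold cubic; fun_prop
  obtain ⟨l, hl, hl0⟩ := intermediate_value_Icc hm0.le hc ⟨h0.le, h1⟩
  refine ⟨l, lt_of_le_of_ne hl.1 ?_, hl0⟩
  rintro rfl
  exact h0.ne hl0

/-- For `l ≤ 0` no term of the cubic is positive, and the constant term is negative. -/
lemma pos_of_cubic_eq_zero {η P l : ℝ} (hP : 0 < P) (hη : η ≠ 0) (h : cubic η P l = 0) :
    0 < l := by
  by_contra! hl
  have h1 : P * l ^ 3 ≤ 0 := mul_nonpos_of_nonneg_of_nonpos hP.le (Odd.pow_nonpos (by decide) hl)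
  have h2 : 6 * P * η ^ 2 * l ≤ 0 := mul_nonpos_of_nonneg_of_nonpos (by positivity) hl
  have h3 : 0 < η ^ 2 := by positivity
  unfold cubic at h
  nlinarith [sq_nonneg l]

lemma objective_lt {η P_N l m : ℝ} (hPN : 0 < P_N) (hl : 0 < l) (hlm : l < m) :
    objective η P_N m < objective η P_N l := by
  have hm : 0 < m := hl.trans hlm
  unfold objective
  apply Real.logb_lt_logb (by norm_num) (by positivity)
  gcongr ?_ + 1
  apply mul_lt_mul
  · have e : ∀ x : ℝ, 0 < x → (x ^ 2 + 6 * η ^ 2) / (x ^ 3 * P_N) =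
        (1 / x + 6 * η ^ 2 / x ^ 3) / P_N := by
      intro x hx; field_simp
    rw [e m hm, e l hl]
    gcongr ?_ / _
    apply add_lt_add_of_lt_of_le
    · gcongr
    · gcongr
  · gcongr
  · positivity
  · positivity

-- Complex Gaussian laws

/-- The density of the circularly symmetric complex Gaussian law of variance `v`. -/
noncomputable def complexGaussianPDF (v : ℝ) (z : ℂ) : ℝ :=
  (Real.pi * v)⁻¹ * Real.exp (-‖z‖ ^ 2 / v)

@[fun_prop]
lemma measurable_complexGaussianPDF (v : ℝ) : Measurable (complexGaussianPDF v) := by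
  unfold complexGaussianPDF; fun_prop

lemma complexGaussianPDF_pos {v : ℝ} (hv : 0 < v) (z : ℂ) : 0 < complexGaussianPDF v z := by
  unfold complexGaussianPDF
  have := Real.pi_pos
  positivity

lemma complexGaussianPDF_le {v : ℝ} (hv : 0 < v) (z : ℂ) :
    complexGaussianPDF v z ≤ (Real.pi * v)⁻¹ := by
  unfold complexGaussianPDF
  have := Real.pi_pos
  apply mul_le_of_le_one_right (by positivity)
  rw [Real.exp_le_one_iff, neg_div]
  have : 0 ≤ ‖z‖ ^ 2 / v := by positivity
  linarith

lemma log_complexGaussianPDF {v : ℝ} (hv : 0 < v) (z : ℂ) :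
    Real.log (complexGaussianPDF v z) = - Real.log (Real.pi * v) - ‖z‖ ^ 2 / v := by
  unfold complexGaussianPDF
  have := Real.pi_pos
  rw [Real.log_mul (by positivity) (Real.exp_pos _).ne', Real.log_exp, Real.log_inv]
  ring

lemma complexGaussian_eq_map (v : ℝ) : complexGaussian v =
    ((gaussianReal 0 (Real.toNNReal (v / 2))).prod (gaussianReal 0 (Real.toNNReal (v / 2)))).map
      Complex.measurableEquivRealProd.symm := by
  unfold complexGaussian
  congr 1
  ext p
  simp [Complex.measurableEquivRealProd_symm_apply, Complex.mk_eq_add_mul_I]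

lemma complexGaussian_eq_withDensity {v : ℝ} (hv : 0 < v) : complexGaussian v =
    volume.withDensity fun z => ENNReal.ofReal (complexGaussianPDF v z) := by
  have hv2 : Real.toNNReal (v / 2) ≠ 0 := by simp [hv]
  rw [complexGaussian_eq_map, gaussianReal_of_var_ne_zero _ hv2,
    prod_withDensity (by fun_prop) (by fun_prop)]
  refine Measure.ext_of_lintegral _ fun φ hφ => ?_
  rw [lintegral_map hφ (by fun_prop), lintegral_withDensity_eq_lintegral_mul _ (by fun_prop)
    (by fun_prop), lintegral_withDensity_eq_lintegral_mul _ (by fun_prop) hφ,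
    ← (Complex.volume_preserving_equiv_real_prod.symm).lintegral_comp (by fun_prop)]
  refine lintegral_congr fun p => ?_
  simp only [Pi.mul_apply, gaussianPDF]
  rw [← ENNReal.ofReal_mul (gaussianPDFReal_nonneg _ _ _)]
  congr 2
  have h1 : ‖Complex.measurableEquivRealProd.symm p‖ ^ 2 = p.1 ^ 2 + p.2 ^ 2 := by
    rw [Complex.measurableEquivRealProd_symm_apply, Complex.sq_norm, Complex.normSq_mk]; ring
  simp only [gaussianPDFReal, complexGaussianPDF, h1, Real.coe_toNNReal _ (half_pos hv).le]
  have := Real.pi_pos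
  have h2 : √(2 * Real.pi * (v / 2)) * √(2 * Real.pi * (v / 2)) = Real.pi * v := by
    rw [Real.mul_self_sqrt (by positivity)]; ring
  rw [mul_mul_mul_comm, ← mul_inv, h2, ← Real.exp_add]
  congr 2
  field_simp
  ring

instance (v : ℝ) : IsGaussian (complexGaussian v) := by
  have : (fun p : ℝ × ℝ => (p.1 : ℂ) + (p.2 : ℂ) * Complex.I) =
      Complex.equivRealProdCLM.symm := by
    ext p
    exact (Complex.mk_eq_add_mul_I _ _).symm
  rw [complexGaussian, this]
  infer_instance

lemma integral_id_complexGaussian (v : ℝ) : ∫ z, id z ∂(complexGaussian v) = 0 := by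
  have : (fun p : ℝ × ℝ => (p.1 : ℂ) + (p.2 : ℂ) * Complex.I) =
      Complex.equivRealProdCLM.symm := by
    ext p
    exact (Complex.mk_eq_add_mul_I _ _).symm
  have hint : Integrable (fun p : ℝ × ℝ => p) ((gaussianReal 0 (Real.toNNReal (v / 2))).prod
      (gaussianReal 0 (Real.toNNReal (v / 2)))) := IsGaussian.integrable_id
  rw [complexGaussian, this, integral_map (by fun_prop) (by fun_prop)]
  simp only [id]
  rw [Complex.equivRealProdCLM.symm.integral_comp_comm, ContinuousLinearEquiv.map_eq_zero_iff]
  ext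
  · rw [fst_integral hint, integral_fun_fst (fun x => x)]
    simp
  · rw [snd_integral hint, integral_fun_snd (fun x => x)]
    simp

lemma map_rotation_complexGaussian (v ψ : ℝ) :
    ((complexGaussian v).prod (complexGaussian v)).map (ContinuousLinearMap.rotation ψ) =
      (complexGaussian v).prod (complexGaussian v) :=
  IsGaussian.map_rotation_eq_self (integral_id_complexGaussian v) ψ

/-- This lets input and noise be driven by two independent copies of one standard law, whose product
is rotation invariant. -/
lemma complexGaussian_eq_map_smul {v : ℝ} (hv : 0 < v) :
    complexGaussian v = (complexGaussian 1).map fun z => ((√v : ℝ) : ℂ) * z := by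
  have h : gaussianReal 0 (Real.toNNReal (v / 2)) =
      (gaussianReal 0 (Real.toNNReal (1 / 2))).map (√v * ·) := by
    rw [gaussianReal_map_const_mul, mul_zero]
    congr 1
    ext
    rw [NNReal.coe_mul, Real.coe_toNNReal _ (by positivity), Real.coe_toNNReal _ (by positivity)]
    simp only [NNReal.coe_mk, Real.sq_sqrt hv.le]
    ring
  rw [complexGaussian, complexGaussian, h, Measure.map_prod_map _ _ (by fun_prop) (by fun_prop),
    Measure.map_map (by fun_prop) (by fun_prop), Measure.map_map (by fun_prop) (by fun_prop)]
  congr 1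
  ext p
  simp
  ring

/-- The squared modulus of a standard complex Gaussian variable is exponentially distributed. -/
lemma lintegral_norm_sq_complexGaussian {h : ℝ → ℝ≥0∞} (hh : Measurable h) :
    ∫⁻ z, h (‖z‖ ^ 2) ∂(complexGaussian 1) =
      ∫⁻ u in Set.Ioi 0, ENNReal.ofReal (Real.exp (-u)) * h u := by
  have hpi := Real.pi_pos
  rw [complexGaussian_eq_withDensity one_pos, lintegral_withDensity_eq_lintegral_mul _
    (by fun_prop) (by fun_prop), ← Complex.lintegral_comp_polarCoord_symm, polarCoord_target]
  have himg : (fun r : ℝ => r ^ 2) '' Set.Ioi 0 = Set.Ioi 0 := by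
    ext u
    simp only [Set.mem_image, Set.mem_Ioi]
    constructor
    · rintro ⟨r, hr, rfl⟩; positivity
    · intro hu; exact ⟨√u, by positivity, Real.sq_sqrt hu.le⟩
  have hinj : Set.InjOn (fun r : ℝ => r ^ 2) (Set.Ioi 0) := fun x hx y hy hxy => by
    exact (sq_eq_sq₀ (le_of_lt hx) (le_of_lt hy)).1 hxy
  -- Substitution `u = r²`: the factor `2r` comes from the polar area element `r` and the angle `2π`
  -- against the normalization `1/π`.
  have hsub := lintegral_image_eq_lintegral_abs_deriv_mul (f := fun r : ℝ => r ^ 2)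
    (f' := fun r => 2 * r) measurableSet_Ioi
    (fun x _ => by simpa using (hasDerivAt_pow 2 x).hasDerivWithinAt) hinj
    (fun u => ENNReal.ofReal (Real.exp (-u)) * h u)
  rw [himg] at hsub
  rw [hsub]
  simp only [Pi.mul_apply, Complex.norm_polarCoord_symm, smul_eq_mul, sq_abs, complexGaussianPDF]
  rw [Measure.volume_eq_prod, ← Measure.prod_restrict, lintegral_prod _ (by fun_prop)]
  refine setLIntegral_congr_fun measurableSet_Ioi fun r hr => ?_
  have hr0 : 0 < r := hr
  simp only [lintegral_const, Measure.restrict_apply_univ, Real.volume_Ioo, mul_one, div_one]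
  rw [abs_of_pos (by positivity), ← mul_assoc, ← mul_assoc, mul_right_comm,
    ← ENNReal.ofReal_mul (by positivity), ← ENNReal.ofReal_mul (by positivity),
    ← ENNReal.ofReal_mul (by positivity)]
  congr 2
  field_simp
  ring

lemma lintegral_exp_neg_mul_pow (n : ℕ) {l : ℝ} (hl : 0 < l) :
    ∫⁻ t in Set.Ioi 0, ENNReal.ofReal (t ^ n * Real.exp (-(l * t))) =
      ENNReal.ofReal (n.factorial / l ^ (n + 1)) := by
  have h : ∫ t in Set.Ioi (0 : ℝ), t ^ n * Real.exp (-(l * t)) = n.factorial / l ^ (n + 1) := by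
    have := Real.integral_rpow_mul_exp_neg_mul_Ioi (a := n + 1) (r := l) (by positivity) hl
    rw [add_sub_cancel_right, Real.Gamma_nat_eq_factorial] at this
    rw [← Nat.cast_add_one] at this
    simp only [Real.rpow_natCast] at this
    rw [this]
    simp only [one_div, inv_pow]
    ring
  -- A Bochner integral is `0` by default when the function is not integrable, so a nonzero value
  -- proves integrability.
  have hne : ∫ t in Set.Ioi (0 : ℝ), t ^ n * Real.exp (-(l * t)) ≠ 0 := by
    rw [h]; positivity
  rw [← h, ofReal_integral_eq_lintegral_ofReal (Integrable.of_integral_ne_zero hne)]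
  filter_upwards [ae_restrict_mem measurableSet_Ioi] with t ht
  have : (0 : ℝ) < t := ht
  positivity

lemma lintegral_norm_sq_complexGaussian_self :
    ∫⁻ z, ENNReal.ofReal (‖z‖ ^ 2) ∂(complexGaussian 1) = 1 := by
  rw [lintegral_norm_sq_complexGaussian (h := ENNReal.ofReal) (by fun_prop)]
  have := lintegral_exp_neg_mul_pow 1 one_pos
  simp only [pow_one, one_mul, Nat.factorial_one, Nat.cast_one, one_pow, div_one,
    ENNReal.ofReal_one] at this
  rw [← this]
  refine lintegral_congr fun u => ?_
  rw [← ENNReal.ofReal_mul (Real.exp_pos _).le, mul_comm]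

-- Output density and information density

@[fun_prop]
lemma measurable_noiseless (η : ℝ) : Measurable (noiseless η) := by
  unfold noiseless; fun_prop

/-- The density of the channel output when the input has law `μ`. -/
noncomputable def outputPDF (η v : ℝ) (μ : Measure ℂ) (y : ℂ) : ℝ≥0∞ :=
  ∫⁻ x, ENNReal.ofReal (complexGaussianPDF v (y - noiseless η x)) ∂μ

lemma jointLaw_fst {η v : ℝ} {μ : Measure ℂ} : (jointLaw η v μ).fst = μ := by
  rw [jointLaw, Measure.fst, Measure.map_map (by fun_prop) (by fun_prop)]
  exact Measure.fst_prod

/-- Given the input, the output is a translate of the noise, and Lebesgue measure is translation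
invariant. -/
lemma jointLaw_eq_withDensity {η v : ℝ} {μ : Measure ℂ} [SFinite μ] (hv : 0 < v) :
    jointLaw η v μ = (μ.prod volume).withDensity
    fun q => ENNReal.ofReal (complexGaussianPDF v (q.2 - noiseless η q.1)) := by
  refine Measure.ext_of_lintegral _ fun φ hφ => ?_
  rw [jointLaw, lintegral_map hφ (by fun_prop), complexGaussian_eq_withDensity hv,
    prod_withDensity_right (by fun_prop), lintegral_withDensity_eq_lintegral_mul _ (by fun_prop)
    (by fun_prop), lintegral_withDensity_eq_lintegral_mul _ (by fun_prop) hφ,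
    lintegral_prod _ (by fun_prop), lintegral_prod _ (by fun_prop)]
  refine lintegral_congr fun x => ?_
  rw [← lintegral_add_left_eq_self (fun y => ((fun q : ℂ × ℂ =>
    ENNReal.ofReal (complexGaussianPDF v (q.2 - noiseless η q.1))) * φ) (x, y)) (noiseless η x)]
  simp

section

variable {η v : ℝ} {μ : Measure ℂ} [IsProbabilityMeasure μ]

@[fun_prop]
lemma measurable_outputPDF : Measurable (outputPDF η v μ) := by
  unfold outputPDF
  exact Measurable.lintegral_prod_right' (f := fun p : ℂ × ℂ =>
    ENNReal.ofReal (complexGaussianPDF v (p.1 - noiseless η p.2))) (by fun_prop)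

lemma outputPDF_lt_top (hv : 0 < v) (y : ℂ) : outputPDF η v μ y < ∞ := by
  refine lt_of_le_of_lt (lintegral_mono (g := fun _ => ENNReal.ofReal ((Real.pi * v)⁻¹))
    fun x => ENNReal.ofReal_le_ofReal (complexGaussianPDF_le hv _)) ?_
  simp

lemma outputPDF_pos (hv : 0 < v) (y : ℂ) : 0 < outputPDF η v μ y := by
  rw [outputPDF, lintegral_pos_iff_support (by fun_prop)]
  have : (Function.support fun x => ENNReal.ofReal (complexGaussianPDF v (y - noiseless η x))) =
      Set.univ := by
    ext x
    simp [complexGaussianPDF_pos hv]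
  simp [this]

instance : IsProbabilityMeasure (jointLaw η v μ) :=
  Measure.isProbabilityMeasure_map (by fun_prop)

lemma jointLaw_snd (hv : 0 < v) : (jointLaw η v μ).snd = volume.withDensity (outputPDF η v μ) := by
  refine Measure.ext_of_lintegral _ fun φ hφ => ?_
  rw [jointLaw_eq_withDensity hv, Measure.snd, lintegral_map hφ (by fun_prop),
    lintegral_withDensity_eq_lintegral_mul _ (by fun_prop) (by fun_prop),
    lintegral_withDensity_eq_lintegral_mul _ (by fun_prop) hφ,
    lintegral_prod_symm _ (by fun_prop)]
  refine lintegral_congr fun y => ?_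
  simp only [Pi.mul_apply]
  rw [lintegral_mul_const _ (by fun_prop)]
  rfl

lemma lintegral_outputPDF (hv : 0 < v) : ∫⁻ y, outputPDF η v μ y = 1 := by
  have h : (jointLaw η v μ).snd Set.univ = 1 := measure_univ
  rwa [jointLaw_snd hv, withDensity_apply _ MeasurableSet.univ, setLIntegral_univ] at h

lemma jointLaw_eq_withDensity_prod (hv : 0 < v) : jointLaw η v μ =
    ((jointLaw η v μ).fst.prod (jointLaw η v μ).snd).withDensity
      fun q => ENNReal.ofReal (complexGaussianPDF v (q.2 - noiseless η q.1)) /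
        outputPDF η v μ q.2 := by
  rw [jointLaw_fst, jointLaw_snd hv, prod_withDensity_right (by fun_prop),
    ← withDensity_mul _ (by fun_prop) (by fun_prop), jointLaw_eq_withDensity hv]
  congr 1
  ext q
  rw [Pi.mul_apply, ENNReal.mul_div_cancel (outputPDF_pos hv _).ne' (outputPDF_lt_top hv _).ne]

lemma llr_jointLaw (hv : 0 < v) :
    llr (jointLaw η v μ) ((jointLaw η v μ).fst.prod (jointLaw η v μ).snd) =ᵐ[jointLaw η v μ]
      fun q => Real.log (complexGaussianPDF v (q.2 - noiseless η q.1)) -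
        Real.log (outputPDF η v μ q.2).toReal := by
  set ν := (jointLaw η v μ).fst.prod (jointLaw η v μ).snd with hν
  have h := jointLaw_eq_withDensity_prod (η := η) (μ := μ) hv
  rw [← hν] at h
  have hac : jointLaw η v μ ≪ ν := h ▸ withDensity_absolutelyContinuous _ _
  have hd := Measure.rnDeriv_withDensity ν (f := fun q : ℂ × ℂ =>
    ENNReal.ofReal (complexGaussianPDF v (q.2 - noiseless η q.1)) / outputPDF η v μ q.2)
    (by fun_prop)
  rw [← h] at hd
  filter_upwards [hac hd] with q hq
  have h1 := complexGaussianPDF_pos hv (q.2 - noiseless η q.1)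
  have h2 := ENNReal.toReal_pos (outputPDF_pos (η := η) (μ := μ) hv q.2).ne'
    (outputPDF_lt_top hv q.2).ne
  rw [llr, hq, ENNReal.toReal_div, ENNReal.toReal_ofReal h1.le, Real.log_div h1.ne' h2.ne']

/-- Either the mutual information is infinite, or the information density is integrable and the
mutual information is its expectation. -/
lemma mutualInfo_jointLaw (hv : 0 < v) : mutualInfo (jointLaw η v μ) = ∞ ∨
    (Integrable (fun q : ℂ × ℂ => Real.log (complexGaussianPDF v q.2) -
      Real.log (outputPDF η v μ (noiseless η q.1 + q.2)).toReal) (μ.prod (complexGaussian v)) ∧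
    mutualInfo (jointLaw η v μ) = ENNReal.ofReal (∫ q : ℂ × ℂ,
      (Real.log (complexGaussianPDF v q.2) -
      Real.log (outputPDF η v μ (noiseless η q.1 + q.2)).toReal) ∂μ.prod (complexGaussian v)) /
      ENNReal.ofReal (Real.log 2)) := by
  set ν := (jointLaw η v μ).fst.prod (jointLaw η v μ).snd with hν
  have hl2 : 0 < Real.log 2 := Real.log_pos (by norm_num)
  by_cases h : jointLaw η v μ ≪ ν ∧ Integrable (llr (jointLaw η v μ) ν) (jointLaw η v μ)
  swap
  · left
    have : InformationTheory.klDiv (jointLaw η v μ) ν = ∞ := by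
      by_contra h'
      exact h (InformationTheory.klDiv_ne_top_iff.1 h')
    rw [mutualInfo, ← hν, this, ENNReal.top_div_of_ne_top ENNReal.ofReal_ne_top]
  right
  obtain ⟨hac, hint⟩ := h
  have hm : Measurable fun q : ℂ × ℂ => Real.log (complexGaussianPDF v (q.2 - noiseless η q.1)) -
        Real.log (outputPDF η v μ q.2).toReal := by fun_prop
  have hint' := (integrable_congr (llr_jointLaw hv)).1 hint
  have hI := integral_congr_ae (llr_jointLaw (η := η) (μ := μ) hv)
  rw [jointLaw, integrable_map_measure hm.aestronglyMeasurable (by fun_prop)] at hint'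
  constructor
  · simpa [Function.comp_def] using hint'
  rw [mutualInfo, ← hν, InformationTheory.klDiv_of_ac_of_integrable hac hint, hI]
  -- The total-mass correction in `klDiv` cancels, both measures being probabilities.
  simp only [probReal_univ, add_sub_cancel_right]
  rw [jointLaw, integral_map (by fun_prop) hm.aestronglyMeasurable]
  simp

end

-- Radial maps of the plane

/-- The map of the plane that keeps arguments and scales by a function `g` of the squared modulus. -/
noncomputable def radialMap (g : ℝ → ℝ) (z : ℂ) : ℂ := g (‖z‖ ^ 2) • z

lemma measurable_radialMap {g : ℝ → ℝ} (hg : Measurable g) : Measurable (radialMap g) := by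
  unfold radialMap; fun_prop

/-- The eigenvalues are `α` across `z` and `α + β‖z‖²` along `z`. -/
lemma det_smul_id_add_smulRight (α β : ℝ) (z : ℂ) :
    (α • ContinuousLinearMap.id ℝ ℂ + (β • innerSL ℝ z).smulRight z).det =
      α * (α + β * ‖z‖ ^ 2) := by
  rw [ContinuousLinearMap.det, ← LinearMap.det_toMatrix Complex.basisOneI, Matrix.det_fin_two]
  simp [LinearMap.toMatrix_apply, Complex.sq_norm, Complex.normSq_apply, Complex.inner]
  ring

lemma hasFDerivAt_radialMap {g : ℝ → ℝ} {z : ℂ} (hg : DifferentiableAt ℝ g (‖z‖ ^ 2)) :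
    HasFDerivAt (radialMap g) (g (‖z‖ ^ 2) • ContinuousLinearMap.id ℝ ℂ +
      ((2 * deriv g (‖z‖ ^ 2)) • innerSL ℝ z).smulRight z) z := by
  have h1 : HasFDerivAt (fun z : ℂ => g (‖z‖ ^ 2))
      ((2 * deriv g (‖z‖ ^ 2)) • innerSL ℝ z) z := by
    refine (hg.hasDerivAt.comp_hasFDerivAt z (hasStrictFDerivAt_norm_sq z).hasFDerivAt).congr_fderiv
      ?_
    ext w
    all_goals simp
    all_goals ring
  exact h1.smul (hasFDerivAt_id z)

/-- By Cauchy–Schwarz the inner product is at least its value for aligned `z`, `w`, where it is the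
one-dimensional monotonicity of `r * g (r²)`. -/
lemma radialMap_monotone {g : ℝ → ℝ} (hg : ∀ u, 0 ≤ u → 0 ≤ g u)
    (hmono : MonotoneOn (fun u => √u * g u) (Set.Ici 0)) (z w : ℂ) :
    0 ≤ inner ℝ (radialMap g z - radialMap g w) (z - w) := by
  have hz := hg (‖z‖ ^ 2) (by positivity)
  have hw := hg (‖w‖ ^ 2) (by positivity)
  have h1 : inner ℝ (radialMap g z - radialMap g w) (z - w) =
      g (‖z‖ ^ 2) * ‖z‖ ^ 2 + g (‖w‖ ^ 2) * ‖w‖ ^ 2 - (g (‖z‖ ^ 2) + g (‖w‖ ^ 2)) * inner ℝ z w := by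
    unfold radialMap
    simp only [inner_sub_left, inner_sub_right, inner_smul_left, real_inner_self_eq_norm_sq,
      real_inner_comm z w]
    simp
    ring
  have h2 := real_inner_le_norm z w
  have h3 : 0 ≤ (‖z‖ * g (‖z‖ ^ 2) - ‖w‖ * g (‖w‖ ^ 2)) * (‖z‖ - ‖w‖) := by
    have key : ∀ x y : ℝ, 0 ≤ x → x ≤ y → x * g (x ^ 2) ≤ y * g (y ^ 2) := by
      intro x y hx hxy
      have := hmono (a := x ^ 2) (b := y ^ 2) (by simp [sq_nonneg]) (by simp [sq_nonneg])
        (by gcongr)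
      simpa [Real.sqrt_sq hx, Real.sqrt_sq (hx.trans hxy)] using this
    rcases le_total ‖z‖ ‖w‖ with h | h
    · exact mul_nonneg_of_nonpos_of_nonpos (by linarith [key _ _ (norm_nonneg z) h]) (by linarith)
    · exact mul_nonneg (by linarith [key _ _ (norm_nonneg w) h]) (by linarith)
  rw [h1]
  nlinarith [mul_le_mul_of_nonneg_left h2 (add_nonneg hz hw)]

-- The rotated sum and its area formula

/-- The sum of the radial transport of `c a - s b` and of `σ (s a + c b)`. -/
noncomputable def rotatedSum (g : ℝ → ℝ) (c s σ : ℝ) (a b : ℂ) : ℂ :=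
  radialMap g (c • a - s • b) + σ • (s • a + c • b)

/-- The Jacobian determinant of `rotatedSum` in the variable `a`, in terms of the squared modulus
`u` of `c a - s b`. -/
noncomputable def rotatedJacobian (g : ℝ → ℝ) (c s σ u : ℝ) : ℝ :=
  (c * g u + s * σ) * (c * (g u + 2 * deriv g u * u) + s * σ)

section

variable {g : ℝ → ℝ} {c s σ : ℝ}

/-- The transport is monotone in `a` and the term `σ s a` strictly so; hence no two values of `a`
can agree. -/
lemma injective_rotatedSum (hg : ∀ u, 0 ≤ u → 0 ≤ g u)
    (hmono : MonotoneOn (fun u => √u * g u) (Set.Ici 0)) (hc : 0 < c) (hs : 0 < s) (hσ : 0 < σ)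
    (b : ℂ) : Function.Injective fun a => rotatedSum g c s σ a b := by
  intro a a' h
  have h1 := radialMap_monotone hg hmono (c • a - s • b) (c • a' - s • b)
  have h2 : radialMap g (c • a - s • b) - radialMap g (c • a' - s • b) = -(σ * s) • (a - a') := by
    simp only [rotatedSum] at h
    rw [sub_eq_iff_eq_add, eq_sub_of_add_eq h]
    module
  have h3 : (c • a - s • b) - (c • a' - s • b) = c • (a - a') := by module
  rw [h2, h3, inner_smul_left, inner_smul_right, real_inner_self_eq_norm_sq] at h1
  simp only [conj_trivial] at h1
  have h4 : 0 < σ * s * c := by positivity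
  have h5 : ‖a - a'‖ ^ 2 ≤ 0 := by
    by_contra! hlt
    nlinarith [mul_pos h4 hlt]
  have h6 : ‖a - a'‖ = 0 := by
    have := norm_nonneg (a - a')
    nlinarith
  exact sub_eq_zero.1 (norm_eq_zero.1 h6)

lemma hasFDerivAt_rotatedSum {a b : ℂ} (hg : DifferentiableAt ℝ g (‖c • a - s • b‖ ^ 2)) :
    ∃ D : ℂ →L[ℝ] ℂ, HasFDerivAt (fun a => rotatedSum g c s σ a b) D a ∧
      D.det = rotatedJacobian g c s σ (‖c • a - s • b‖ ^ 2) := by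
  set z := c • a - s • b with hz
  have h1 : HasFDerivAt (fun a : ℂ => c • a - s • b) (c • ContinuousLinearMap.id ℝ ℂ) a :=
    ((hasFDerivAt_id a).const_smul c).sub_const _
  have h2 : HasFDerivAt (fun a : ℂ => σ • (s • a + c • b))
      (σ • s • ContinuousLinearMap.id ℝ ℂ) a :=
    (((hasFDerivAt_id a).const_smul s).add_const _).const_smul σ
  have h3 := ((hasFDerivAt_radialMap hg).comp a h1).add h2
  refine ⟨_, h3, ?_⟩
  have h4 : ((g (‖z‖ ^ 2) • ContinuousLinearMap.id ℝ ℂ +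
      ((2 * deriv g (‖z‖ ^ 2)) • innerSL ℝ z).smulRight z).comp
        (c • ContinuousLinearMap.id ℝ ℂ) + σ • s • ContinuousLinearMap.id ℝ ℂ) =
      (c * g (‖z‖ ^ 2) + s * σ) • ContinuousLinearMap.id ℝ ℂ +
        ((c * (2 * deriv g (‖z‖ ^ 2))) • innerSL ℝ z).smulRight z := by
    ext
    all_goals simp
    all_goals ring
  rw [h4, det_smul_id_add_smulRight, rotatedJacobian]
  ring

/-- The area formula for `rotatedSum`. -/
lemma lintegral_jacobian_mul_comp_rotatedSum_le (hg : ∀ u, 0 ≤ u → 0 ≤ g u)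
    (hmono : MonotoneOn (fun u => √u * g u) (Set.Ici 0)) (hd : ∀ u, 0 < u → DifferentiableAt ℝ g u)
    (hc : 0 < c) (hs : 0 < s) (hσ : 0 < σ) (q : ℂ → ℝ≥0∞) (b : ℂ) :
    ∫⁻ a, ENNReal.ofReal (rotatedJacobian g c s σ (‖c • a - s • b‖ ^ 2)) *
      q (rotatedSum g c s σ a b) ≤ ∫⁻ y, q y := by
  -- `g` need not be differentiable at `0`, so the single point `a` where the argument of the radial
  -- map vanishes is removed.
  have hset : {a : ℂ | c • a - s • b ≠ 0} = {c⁻¹ • s • b}ᶜ := by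
    ext a
    simp only [Set.mem_ofPred_eq, Set.mem_compl_iff, Set.mem_singleton_iff, sub_ne_zero]
    rw [not_iff_not, eq_inv_smul_iff₀ hc.ne']
  set S := {a : ℂ | c • a - s • b ≠ 0} with hS
  have hSm : MeasurableSet S := by rw [hset]; exact (measurableSet_singleton _).compl
  have hD : ∀ a ∈ S, ∃ D : ℂ →L[ℝ] ℂ, HasFDerivWithinAt (fun a => rotatedSum g c s σ a b) D S a ∧
      D.det = rotatedJacobian g c s σ (‖c • a - s • b‖ ^ 2) := by
    intro a ha
    have : c • a - s • b ≠ 0 := ha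
    obtain ⟨D, h1, h2⟩ := hasFDerivAt_rotatedSum (g := g) (c := c) (s := s) (σ := σ)
      (hd (‖c • a - s • b‖ ^ 2) (by positivity))
    exact ⟨D, h1.hasFDerivWithinAt, h2⟩
  choose! D hD1 hD2 using hD
  have harea := lintegral_image_eq_lintegral_abs_det_fderiv_mul volume hSm hD1
    (injective_rotatedSum hg hmono hc hs hσ b).injOn q
  have hae : S =ᵐ[volume] Set.univ := by
    rw [hset, ae_eq_univ, compl_compl]
    exact measure_singleton _
  rw [← setLIntegral_univ, ← setLIntegral_congr hae]
  calc _ ≤ ∫⁻ a in S, ENNReal.ofReal |(D a).det| * q (rotatedSum g c s σ a b) := by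
        refine setLIntegral_mono' hSm fun a ha => ?_
        gcongr
        rw [hD2 a ha]
        exact le_abs_self _
    _ ≤ ∫⁻ y, q y := by
        rw [← harea]
        exact setLIntegral_le_lintegral _ _

end

-- The entropy power inequality by transport

/-- Concavity of `log` at `x / c` and `y / s` with weights `c²` and `s²`. It is applied to both
eigenvalues of the Jacobian. -/
lemma le_log_mul_add_mul {c s x y : ℝ} (hc : 0 < c) (hs : 0 < s) (hcs : c ^ 2 + s ^ 2 = 1)
    (hx : 0 < x) (hy : 0 < y) :
    c ^ 2 * Real.log x + s ^ 2 * Real.log y - c ^ 2 * Real.log c - s ^ 2 * Real.log s ≤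
      Real.log (c * x + s * y) := by
  have h := strictConcaveOn_log_Ioi.concaveOn.2 (x := x / c) (y := y / s)
    (show 0 < x / c by positivity) (show 0 < y / s by positivity) (sq_nonneg c) (sq_nonneg s) hcs
  simp only [smul_eq_mul] at h
  rw [Real.log_div hx.ne' hc.ne', Real.log_div hy.ne' hs.ne'] at h
  have e : c ^ 2 * (x / c) + s ^ 2 * (y / s) = c * x + s * y := by field_simp
  rw [e] at h
  linarith

lemma integral_linear_combination {α : Type*} [MeasurableSpace α] {μ : Measure α}
    [IsProbabilityMeasure μ] {f₁ f₂ f₃ : α → ℝ} (h₁ : Integrable f₁ μ) (h₂ : Integrable f₂ μ)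
    (h₃ : Integrable f₃ μ) {k m : ℝ} : ∫ x, (f₁ x + k * f₂ x + f₃ x + m) ∂μ =
      ∫ x, f₁ x ∂μ + k * ∫ x, f₂ x ∂μ + ∫ x, f₃ x ∂μ + m := by
  have h₂' : Integrable (fun x => k * f₂ x) μ := h₂.const_mul k
  have h₁₂ : Integrable (fun x => f₁ x + k * f₂ x) μ := h₁.add h₂'
  have h₁₂₃ : Integrable (fun x => f₁ x + k * f₂ x + f₃ x) μ := h₁₂.add h₃
  rw [integral_add h₁₂₃ (integrable_const m), integral_add h₁₂ h₃, integral_add h₁ h₂',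
    integral_const_mul]
  simp

section

variable {g : ℝ → ℝ} {c s σ : ℝ}

lemma rotatedJacobian_pos (hpos : ∀ u, 0 < u → 0 < g u)
    (hder : ∀ u, 0 < u → 0 < g u + 2 * deriv g u * u) (hc : 0 < c) (hs : 0 < s) (hσ : 0 < σ)
    {u : ℝ} (hu : 0 < u) : 0 < rotatedJacobian g c s σ u := by
  have := hpos u hu
  have := hder u hu
  unfold rotatedJacobian
  positivity

lemma le_log_rotatedJacobian (hpos : ∀ u, 0 < u → 0 < g u)
    (hder : ∀ u, 0 < u → 0 < g u + 2 * deriv g u * u) (hc : 0 < c) (hs : 0 < s)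
    (hcs : c ^ 2 + s ^ 2 = 1) (hσ : 0 < σ) {u : ℝ} (hu : 0 < u) :
    c ^ 2 * Real.log (g u * (g u + 2 * deriv g u * u)) +
      2 * (s ^ 2 * Real.log σ - c ^ 2 * Real.log c - s ^ 2 * Real.log s) ≤
      Real.log (rotatedJacobian g c s σ u) := by
  have h1 := hpos u hu
  have h2 := hder u hu
  have h3 := le_log_mul_add_mul hc hs hcs h1 hσ
  have h4 := le_log_mul_add_mul hc hs hcs h2 hσ
  rw [Real.log_mul h1.ne' h2.ne', rotatedJacobian, Real.log_mul (by positivity) (by positivity)]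
  linarith

lemma measurePreserving_rotate (ψ : ℝ) :
    MeasurePreserving (fun q : ℂ × ℂ => (Real.cos ψ • q.1 - Real.sin ψ • q.2,
      Real.sin ψ • q.1 + Real.cos ψ • q.2)) ((complexGaussian 1).prod (complexGaussian 1))
      ((complexGaussian 1).prod (complexGaussian 1)) := by
  refine ⟨by fun_prop, ?_⟩
  -- The angle is negated because `ContinuousLinearMap.rotation` turns the other way.
  convert map_rotation_complexGaussian 1 (-ψ) using 2
  ext q <;> simp [ContinuousLinearMap.rotation_apply, sub_eq_add_neg]

lemma integrable_norm_sq_complexGaussian :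
    Integrable (fun z : ℂ => ‖z‖ ^ 2) (complexGaussian 1) := by
  refine ⟨by fun_prop, ?_⟩
  rw [hasFiniteIntegral_iff_ofReal (ae_of_all _ fun z => by positivity),
    lintegral_norm_sq_complexGaussian_self]
  exact ENNReal.one_lt_top

lemma integral_norm_sq_complexGaussian : ∫ z : ℂ, ‖z‖ ^ 2 ∂(complexGaussian 1) = 1 := by
  rw [integral_eq_lintegral_of_nonneg_ae (ae_of_all _ fun z => by positivity) (by fun_prop),
    lintegral_norm_sq_complexGaussian_self, ENNReal.toReal_one]

lemma ae_complexGaussian_ne_zero : ∀ᵐ z ∂(complexGaussian 1), z ≠ 0 := by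
  rw [complexGaussian_eq_withDensity one_pos]
  exact (withDensity_absolutelyContinuous _ _).ae_le (Measure.ae_ne volume 0)

/-- The likelihood ratio of a change of variables, integrated against the Gaussian law. -/
lemma lintegral_likelihoodRatio_le (hg : ∀ u, 0 ≤ u → 0 ≤ g u)
    (hmono : MonotoneOn (fun u => √u * g u) (Set.Ici 0)) (hd : ∀ u, 0 < u → DifferentiableAt ℝ g u)
    (hm : Measurable g) (hc : 0 < c) (hs : 0 < s) (hσ : 0 < σ) {p : ℂ → ℝ≥0∞} (hp : Measurable p)
    (hp_top : ∀ y, p y < ∞) (hp1 : ∫⁻ y, p y ≤ 1) :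
    ∫⁻ q : ℂ × ℂ, ENNReal.ofReal ((p (rotatedSum g c s σ q.1 q.2)).toReal *
        rotatedJacobian g c s σ (‖c • q.1 - s • q.2‖ ^ 2) / complexGaussianPDF 1 q.1)
      ∂((complexGaussian 1).prod (complexGaussian 1)) ≤ 1 := by
  have hmJ : Measurable (rotatedJacobian g c s σ) := by unfold rotatedJacobian; fun_prop
  have hmF : Measurable fun q : ℂ × ℂ => rotatedSum g c s σ q.1 q.2 := by
    have := measurable_radialMap hm
    unfold rotatedSum; fun_prop
  have hmU : Measurable fun q : ℂ × ℂ => ENNReal.ofReal ((p (rotatedSum g c s σ q.1 q.2)).toReal *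
      rotatedJacobian g c s σ (‖c • q.1 - s • q.2‖ ^ 2) / complexGaussianPDF 1 q.1) := by
    fun_prop
  rw [lintegral_prod_symm _ hmU.aemeasurable]
  have hb : ∀ b, ∫⁻ a, ENNReal.ofReal ((p (rotatedSum g c s σ a b)).toReal *
      rotatedJacobian g c s σ (‖c • a - s • b‖ ^ 2) / complexGaussianPDF 1 a)
      ∂(complexGaussian 1) ≤ 1 := by
    intro b
    have hmFb : Measurable fun a => rotatedSum g c s σ a b := by
      have := measurable_radialMap hm
      unfold rotatedSum; fun_prop
    have hmUb : Measurable fun a => ENNReal.ofReal ((p (rotatedSum g c s σ a b)).toReal *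
        rotatedJacobian g c s σ (‖c • a - s • b‖ ^ 2) / complexGaussianPDF 1 a) := by
      fun_prop
    rw [complexGaussian_eq_withDensity one_pos,
      lintegral_withDensity_eq_lintegral_mul _ (by fun_prop) hmUb]
    -- The Gaussian density cancels the denominator, leaving the area formula for fixed `b`.
    refine le_trans (le_of_eq ?_) ((lintegral_jacobian_mul_comp_rotatedSum_le hg hmono hd hc hs hσ
      p b).trans hp1)
    refine lintegral_congr fun a => ?_
    have hpdf := complexGaussianPDF_pos one_pos a
    rw [Pi.mul_apply, ← ENNReal.ofReal_mul hpdf.le, mul_div_cancel₀ _ hpdf.ne', mul_comm,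
      ENNReal.ofReal_mul' ENNReal.toReal_nonneg, ENNReal.ofReal_toReal (hp_top _).ne]
  refine (lintegral_mono hb).trans ?_
  simp

/-- An upper bound on the expected log-density at the sum of a radial transport of a Gaussian
variable and an independent Gaussian variable. -/
theorem integral_log_add_le (hpos : ∀ u, 0 < u → 0 < g u) (hg : ∀ u, 0 ≤ u → 0 ≤ g u)
    (hmono : MonotoneOn (fun u => √u * g u) (Set.Ici 0)) (hd : ∀ u, 0 < u → DifferentiableAt ℝ g u)
    (hder : ∀ u, 0 < u → 0 < g u + 2 * deriv g u * u)
    (hm : Measurable g) (hc : 0 < c) (hs : 0 < s) (hcs : c ^ 2 + s ^ 2 = 1) (hσ : 0 < σ)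
    {p : ℂ → ℝ≥0∞} (hp : Measurable p)
    (hp_pos : ∀ y, 0 < p y) (hp_top : ∀ y, p y < ∞) (hp1 : ∫⁻ y, p y ≤ 1)
    (hlog : Integrable (fun q : ℂ × ℂ => Real.log (p (radialMap g q.1 + σ • q.2)).toReal)
      ((complexGaussian 1).prod (complexGaussian 1)))
    (hjac : Integrable (fun z : ℂ => Real.log (g (‖z‖ ^ 2) *
      (g (‖z‖ ^ 2) + 2 * deriv g (‖z‖ ^ 2) * ‖z‖ ^ 2))) (complexGaussian 1)) :
    ∫ q : ℂ × ℂ, Real.log (p (radialMap g q.1 + σ • q.2)).toReal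
      ∂((complexGaussian 1).prod (complexGaussian 1)) +
    c ^ 2 * ∫ z : ℂ, Real.log (g (‖z‖ ^ 2) *
      (g (‖z‖ ^ 2) + 2 * deriv g (‖z‖ ^ 2) * ‖z‖ ^ 2)) ∂(complexGaussian 1) +
    2 * (s ^ 2 * Real.log σ - c ^ 2 * Real.log c - s ^ 2 * Real.log s) + 1 + Real.log Real.pi
      ≤ 0 := by
  set γ := complexGaussian 1 with hγ
  obtain ⟨ψ, rfl, rfl⟩ : ∃ ψ, c = Real.cos ψ ∧ s = Real.sin ψ := by
    refine ⟨Real.arccos c, ?_, ?_⟩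
    · rw [Real.cos_arccos (by linarith) (by nlinarith)]
    · rw [Real.sin_arccos, ← hcs, add_sub_cancel_left, Real.sqrt_sq hs.le]
  set c := Real.cos ψ
  set s := Real.sin ψ
  set K := 2 * (s ^ 2 * Real.log σ - c ^ 2 * Real.log c - s ^ 2 * Real.log s) with hK
  have hmJ : Measurable (rotatedJacobian g c s σ) := by unfold rotatedJacobian; fun_prop
  have hmF : Measurable fun q : ℂ × ℂ => rotatedSum g c s σ q.1 q.2 := by
    have := measurable_radialMap hm
    unfold rotatedSum; fun_prop
  have hrot := measurePreserving_rotate ψ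
  rw [← hγ] at hrot
  have hjac' := hjac.comp_fst γ
  have i1 : Integrable (fun q : ℂ × ℂ => Real.log (p (rotatedSum g c s σ q.1 q.2)).toReal)
      (γ.prod γ) := hrot.integrable_comp_of_integrable hlog
  have i2 : Integrable (fun q : ℂ × ℂ => Real.log (g (‖c • q.1 - s • q.2‖ ^ 2) *
      (g (‖c • q.1 - s • q.2‖ ^ 2) + 2 * deriv g (‖c • q.1 - s • q.2‖ ^ 2) *
        ‖c • q.1 - s • q.2‖ ^ 2))) (γ.prod γ) :=
    hrot.integrable_comp_of_integrable hjac'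
  have e1 : ∫ q : ℂ × ℂ, Real.log (p (rotatedSum g c s σ q.1 q.2)).toReal ∂(γ.prod γ) =
      ∫ q : ℂ × ℂ, Real.log (p (radialMap g q.1 + σ • q.2)).toReal ∂(γ.prod γ) := by
    have h := integral_map (μ := γ.prod γ) hrot.measurable.aemeasurable
      (by rw [hrot.map_eq]; exact hlog.1)
    rw [hrot.map_eq] at h
    exact h.symm
  have e2 : ∫ q : ℂ × ℂ, Real.log (g (‖c • q.1 - s • q.2‖ ^ 2) *
      (g (‖c • q.1 - s • q.2‖ ^ 2) + 2 * deriv g (‖c • q.1 - s • q.2‖ ^ 2) *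
        ‖c • q.1 - s • q.2‖ ^ 2)) ∂(γ.prod γ) = ∫ z : ℂ, Real.log (g (‖z‖ ^ 2) *
      (g (‖z‖ ^ 2) + 2 * deriv g (‖z‖ ^ 2) * ‖z‖ ^ 2)) ∂γ := by
    have h := integral_map (μ := γ.prod γ) hrot.measurable.aemeasurable
      (by rw [hrot.map_eq]; exact hjac'.1)
    rw [hrot.map_eq] at h
    rw [← h, integral_fun_fst (fun z : ℂ => Real.log (g (‖z‖ ^ 2) *
      (g (‖z‖ ^ 2) + 2 * deriv g (‖z‖ ^ 2) * ‖z‖ ^ 2)))]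
    simp
  have i3 : Integrable (fun q : ℂ × ℂ => ‖q.1‖ ^ 2) (γ.prod γ) :=
    integrable_norm_sq_complexGaussian.comp_fst γ
  have e3 : ∫ q : ℂ × ℂ, ‖q.1‖ ^ 2 ∂(γ.prod γ) = 1 := by
    rw [integral_fun_fst (fun z : ℂ => ‖z‖ ^ 2), integral_norm_sq_complexGaussian]
    simp
  set U : ℂ × ℂ → ℝ := fun q => (p (rotatedSum g c s σ q.1 q.2)).toReal *
        rotatedJacobian g c s σ (‖c • q.1 - s • q.2‖ ^ 2) / complexGaussianPDF 1 q.1 with hU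
  have hae : ∀ᵐ q ∂(γ.prod γ), c • q.1 - s • q.2 ≠ 0 := by
    have h1 : ∀ᵐ q ∂(γ.prod γ), q.1 ≠ 0 :=
      Measure.quasiMeasurePreserving_fst.ae ae_complexGaussian_ne_zero
    exact hrot.quasiMeasurePreserving.ae h1
  have hUmeas : Measurable U := by fun_prop
  have hUpos : ∀ᵐ q ∂(γ.prod γ), 0 < U q := by
    filter_upwards [hae] with q hq
    have h1 := ENNReal.toReal_pos (hp_pos (rotatedSum g c s σ q.1 q.2)).ne' (hp_top _).ne
    have h2 := rotatedJacobian_pos hpos hder hc hs hσ (u := ‖c • q.1 - s • q.2‖ ^ 2)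
      (by positivity)
    have h3 := complexGaussianPDF_pos one_pos q.1
    simp only [hU]
    positivity
  have hUle := lintegral_likelihoodRatio_le hg hmono hd hm hc hs hσ hp hp_top hp1
  rw [← hγ] at hUle
  have iU : Integrable U (γ.prod γ) := by
    refine ⟨hUmeas.aestronglyMeasurable, ?_⟩
    rw [hasFiniteIntegral_iff_ofReal (hUpos.mono fun _ h => h.le)]
    exact hUle.trans_lt ENNReal.one_lt_top
  have eU : ∫ q, U q ∂(γ.prod γ) ≤ 1 := by
    rw [integral_eq_lintegral_of_nonneg_ae (hUpos.mono fun _ h => h.le)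
      hUmeas.aestronglyMeasurable]
    exact ENNReal.toReal_le_of_le_ofReal zero_le_one (by rw [ENNReal.ofReal_one]; exact hUle)
  have key : ∫ q : ℂ × ℂ, (Real.log (p (rotatedSum g c s σ q.1 q.2)).toReal +
      c ^ 2 * Real.log (g (‖c • q.1 - s • q.2‖ ^ 2) *
      (g (‖c • q.1 - s • q.2‖ ^ 2) + 2 * deriv g (‖c • q.1 - s • q.2‖ ^ 2) *
        ‖c • q.1 - s • q.2‖ ^ 2)) + ‖q.1‖ ^ 2 + (K + Real.log Real.pi)) ∂(γ.prod γ) ≤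
      ∫ q, (U q - 1) ∂(γ.prod γ) := by
    -- Pointwise, the left side is at most `log U ≤ U - 1`; the term `‖q.1‖² + log π` is minus the
    -- Gaussian log-density.
    refine integral_mono_ae (((i1.add (i2.const_mul _)).add i3).add (integrable_const _))
      (iU.sub (integrable_const _)) ?_
    filter_upwards [hae, hUpos] with q hq hq2
    have h1 := ENNReal.toReal_pos (hp_pos (rotatedSum g c s σ q.1 q.2)).ne' (hp_top _).ne
    have h2 := rotatedJacobian_pos hpos hder hc hs hσ (u := ‖c • q.1 - s • q.2‖ ^ 2)
      (by positivity)
    have h3 := complexGaussianPDF_pos one_pos q.1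
    have h4 := le_log_rotatedJacobian hpos hder hc hs hcs hσ (u := ‖c • q.1 - s • q.2‖ ^ 2)
      (by positivity)
    have h5 := Real.log_le_sub_one_of_pos hq2
    have h6 : Real.log (U q) = Real.log (p (rotatedSum g c s σ q.1 q.2)).toReal +
        Real.log (rotatedJacobian g c s σ (‖c • q.1 - s • q.2‖ ^ 2)) + Real.log Real.pi +
        ‖q.1‖ ^ 2 := by
      simp only [hU]
      rw [Real.log_div (by positivity) h3.ne', Real.log_mul h1.ne' h2.ne',
        log_complexGaussianPDF one_pos]
      simp only [mul_one, div_one]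
      ring
    linarith
  rw [integral_linear_combination i1 i2 i3, integral_sub iU (integrable_const _), e1, e2, e3] at key
  simp only [integral_const, probReal_univ, one_smul] at key
  linarith

end

-- The law of the input power and its transport

/-- The polynomial factor of the survival function `survivalPoly t * exp (-l t)` of the squared
modulus of the channel input. -/
noncomputable def survivalPoly (η l t : ℝ) : ℝ :=
  1 + 6 * η ^ 2 * l / (l ^ 2 + 6 * η ^ 2) * t + 3 * η ^ 2 * l ^ 2 / (l ^ 2 + 6 * η ^ 2) * t ^ 2

/-- The cumulative hazard of the squared modulus of the channel input, extended by the identity to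
negative arguments. -/
noncomputable def hazard (η l t : ℝ) : ℝ :=
  l * max t 0 - Real.log (survivalPoly η l (max t 0)) + min t 0

/-- The squared modulus of the noiseless output, for an input of squared modulus `t`. -/
def outputPower (η t : ℝ) : ℝ := t + η ^ 2 * t ^ 3

section

variable {η l : ℝ}

lemma survivalPoly_pos (hl : 0 < l) {t : ℝ} (ht : 0 ≤ t) : 0 < survivalPoly η l t := by
  unfold survivalPoly; positivity

lemma continuous_hazard (hl : 0 < l) : Continuous (hazard η l) := by
  have h : Continuous fun t => survivalPoly η l (max t 0) := by unfold survivalPoly; fun_prop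
  unfold hazard
  have := h.log fun t => (survivalPoly_pos hl (le_max_right t 0)).ne'
  fun_prop

lemma hazard_of_nonneg {t : ℝ} (ht : 0 ≤ t) :
    hazard η l t = l * t - Real.log (survivalPoly η l t) := by
  simp [hazard, ht]

lemma hazard_of_nonpos {t : ℝ} (ht : t ≤ 0) : hazard η l t = t := by
  simp [hazard, survivalPoly, ht]

/-- `survivalPoly` is chosen so that derivative times survival function is the density `κ(1 +
3η²t²)e^{-lt}`. -/
lemma hasDerivAt_hazard (hl : 0 < l) {t : ℝ} (ht : 0 < t) :
    HasDerivAt (hazard η l)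
      (l ^ 3 / (l ^ 2 + 6 * η ^ 2) * (1 + 3 * η ^ 2 * t ^ 2) / survivalPoly η l t) t := by
  have hq := survivalPoly_pos (η := η) hl ht.le
  have h1 : HasDerivAt (survivalPoly η l) (6 * η ^ 2 * l / (l ^ 2 + 6 * η ^ 2) +
      3 * η ^ 2 * l ^ 2 / (l ^ 2 + 6 * η ^ 2) * (2 * t)) t := by
    unfold survivalPoly
    have := (((hasDerivAt_id t).const_mul (6 * η ^ 2 * l / (l ^ 2 + 6 * η ^ 2))).const_add 1).add
      ((hasDerivAt_pow 2 t).const_mul (3 * η ^ 2 * l ^ 2 / (l ^ 2 + 6 * η ^ 2)))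
    exact this.congr_deriv (by simp)
  have h2 : HasDerivAt (fun t => l * t - Real.log (survivalPoly η l t)) (l - (6 * η ^ 2 * l /
      (l ^ 2 + 6 * η ^ 2) + 3 * η ^ 2 * l ^ 2 / (l ^ 2 + 6 * η ^ 2) * (2 * t)) /
      survivalPoly η l t) t := by
    have := ((hasDerivAt_id t).const_mul l).sub (h1.log hq.ne')
    exact this.congr_deriv (by simp)
  have h3 : hazard η l =ᶠ[nhds t] fun t => l * t - Real.log (survivalPoly η l t) := by
    filter_upwards [lt_mem_nhds ht] with x hx using hazard_of_nonneg hx.le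
  refine (h2.congr_of_eventuallyEq h3).congr_deriv ?_
  rw [eq_div_iff hq.ne', sub_mul, div_mul_cancel₀ _ hq.ne']
  unfold survivalPoly
  field_simp
  ring

lemma strictMono_hazard (hl : 0 < l) : StrictMono (hazard η l) := by
  have h1 : StrictMonoOn (hazard η l) (Set.Ici 0) := by
    refine strictMonoOn_of_deriv_pos (convex_Ici 0) (continuous_hazard hl).continuousOn ?_
    intro t ht
    rw [interior_Ici] at ht
    have ht' : 0 < t := ht
    rw [(hasDerivAt_hazard hl ht').deriv]
    have := survivalPoly_pos (η := η) hl ht'.le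
    positivity
  have h2 : StrictMonoOn (hazard η l) (Set.Iic 0) := by
    intro x hx y hy hxy
    rwa [hazard_of_nonpos hx, hazard_of_nonpos hy]
  exact h2.Iic_union_Ici h1

/-- Surjectivity onto all of `ℝ` makes the inverse an order isomorphism, hence continuous. -/
lemma surjective_hazard (hl : 0 < l) : Function.Surjective (hazard η l) := by
  refine (continuous_hazard hl).surjective ?_ ?_
  -- `C` adds up the coefficients of `survivalPoly` in the basis `1, x, x²/2` with `x = l t / 2`, so
  -- `survivalPoly ≤ C eˣ` and its logarithm uses up only half of `l t`.
  · set C := 1 + 12 * η ^ 2 / (l ^ 2 + 6 * η ^ 2) + 24 * η ^ 2 / (l ^ 2 + 6 * η ^ 2) with hC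
    have hCpos : 0 < C := by positivity
    have h : ∀ᶠ t in Filter.atTop, l / 2 * t - Real.log C ≤ hazard η l t := by
      filter_upwards [Filter.eventually_ge_atTop 0] with t ht
      rw [hazard_of_nonneg ht]
      have hx : 0 ≤ l / 2 * t := by positivity
      have h1 := Real.quadratic_le_exp_of_nonneg hx
      have h2 : survivalPoly η l t ≤ C * Real.exp (l / 2 * t) := by
        refine le_trans ?_ (mul_le_mul_of_nonneg_left h1 hCpos.le)
        have e : C * (1 + l / 2 * t + (l / 2 * t) ^ 2 / 2) - survivalPoly η l t =
          (C - 1) + (1 + 24 * η ^ 2 / (l ^ 2 + 6 * η ^ 2)) * (l / 2 * t) +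
            (1 + 12 * η ^ 2 / (l ^ 2 + 6 * η ^ 2)) * ((l / 2 * t) ^ 2 / 2) := by
          rw [hC]; unfold survivalPoly; field_simp; ring
        have : 0 ≤ C - 1 := by rw [hC, add_assoc, add_sub_cancel_left]; positivity
        have : 0 ≤ C * (1 + l / 2 * t + (l / 2 * t) ^ 2 / 2) - survivalPoly η l t := by
          rw [e]; positivity
        linarith
      have h3 := Real.log_le_log (survivalPoly_pos hl ht) h2
      rw [Real.log_mul hCpos.ne' (Real.exp_pos _).ne', Real.log_exp] at h3
      linarith
    refine Filter.tendsto_atTop_mono' _ h ?_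
    exact Filter.tendsto_atTop_add_const_right _ _
      (Filter.tendsto_id.const_mul_atTop (by positivity))
  · refine Filter.tendsto_id.congr' ?_
    filter_upwards [Filter.eventually_le_atBot 0] with t ht using (hazard_of_nonpos ht).symm

end

/-- The squared modulus of the channel input, as a function of that of a standard complex Gaussian
variable. -/
noncomputable def inputPower (η l : ℝ) (hl : 0 < l) : ℝ ≃o ℝ :=
  ((strictMono_hazard (η := η) hl).orderIsoOfSurjective _ (surjective_hazard hl)).symm

/-- The radial scaling that transports a standard complex Gaussian variable to the noiseless
output. -/
noncomputable def transportScale (η l : ℝ) (hl : 0 < l) (u : ℝ) : ℝ :=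
  √(outputPower η (inputPower η l hl u) / u)

section

variable {η l : ℝ} (hl : 0 < l)

lemma hazard_inputPower (u : ℝ) : hazard η l (inputPower η l hl u) = u :=
  ((strictMono_hazard (η := η) hl).orderIsoOfSurjective _ (surjective_hazard hl)).apply_symm_apply u

lemma inputPower_hazard (t : ℝ) : inputPower η l hl (hazard η l t) = t :=
  ((strictMono_hazard (η := η) hl).orderIsoOfSurjective _ (surjective_hazard hl)).symm_apply_apply t

lemma inputPower_zero : inputPower η l hl 0 = 0 := by
  conv_lhs => rw [← hazard_of_nonpos (η := η) (l := l) le_rfl]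
  exact inputPower_hazard hl 0

lemma inputPower_pos {u : ℝ} (hu : 0 < u) : 0 < inputPower η l hl u := by
  rw [← inputPower_zero (η := η) hl]
  exact (inputPower η l hl).strictMono hu

lemma inputPower_nonneg {u : ℝ} (hu : 0 ≤ u) : 0 ≤ inputPower η l hl u := by
  rw [← inputPower_zero (η := η) hl]
  exact (inputPower η l hl).monotone hu

@[fun_prop]
lemma continuous_inputPower : Continuous (inputPower η l hl) := (inputPower η l hl).continuous

lemma hasDerivAt_inputPower {u : ℝ} (hu : 0 < u) : HasDerivAt (inputPower η l hl)
    (l ^ 3 / (l ^ 2 + 6 * η ^ 2) * (1 + 3 * η ^ 2 * inputPower η l hl u ^ 2) /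
      survivalPoly η l (inputPower η l hl u))⁻¹ u := by
  have ht := inputPower_pos (η := η) hl hu
  have hq := survivalPoly_pos (η := η) hl ht.le
  exact (hasDerivAt_hazard hl ht).of_local_left_inverse (continuous_inputPower hl).continuousAt
    (by positivity) (Filter.Eventually.of_forall (hazard_inputPower hl))

lemma outputPower_nonneg {t : ℝ} (ht : 0 ≤ t) : 0 ≤ outputPower η t := by
  unfold outputPower; positivity

lemma outputPower_pos {t : ℝ} (ht : 0 < t) : 0 < outputPower η t := by
  unfold outputPower; positivity

@[fun_prop]
lemma measurable_transportScale : Measurable (transportScale η l hl) := by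
  have := (continuous_inputPower (η := η) hl).measurable
  unfold transportScale outputPower; fun_prop

lemma transportScale_nonneg (u : ℝ) : 0 ≤ transportScale η l hl u := Real.sqrt_nonneg _

lemma transportScale_pos {u : ℝ} (hu : 0 < u) : 0 < transportScale η l hl u :=
  Real.sqrt_pos.2 (div_pos (outputPower_pos (inputPower_pos hl hu)) hu)

lemma transportScale_sq_mul {u : ℝ} (hu : 0 ≤ u) :
    transportScale η l hl u ^ 2 * u = outputPower η (inputPower η l hl u) := by
  rcases hu.eq_or_lt with rfl | hu'
  · simp [inputPower_zero, outputPower]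
  · rw [transportScale, Real.sq_sqrt (div_nonneg (outputPower_nonneg (inputPower_nonneg hl hu)) hu),
      div_mul_cancel₀ _ hu'.ne']

/-- The product is the modulus of the noiseless output, which grows with the input power. -/
lemma monotoneOn_sqrt_mul_transportScale :
    MonotoneOn (fun u => √u * transportScale η l hl u) (Set.Ici 0) := by
  have key : ∀ u, 0 ≤ u → √u * transportScale η l hl u = √(outputPower η (inputPower η l hl u)) := by
    intro u hu
    rw [← transportScale_sq_mul hl hu, Real.sqrt_mul (sq_nonneg _),
      Real.sqrt_sq (transportScale_nonneg hl u), mul_comm]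
  intro u hu v hv huv
  have h0 := inputPower_nonneg (η := η) hl hu
  have h1 := (inputPower η l hl).monotone huv
  simp only [key u hu, key v hv]
  apply Real.sqrt_le_sqrt
  unfold outputPower
  gcongr

lemma differentiableAt_transportScale {u : ℝ} (hu : 0 < u) :
    DifferentiableAt ℝ (transportScale η l hl) u := by
  have h1 := (hasDerivAt_inputPower (η := η) hl hu).differentiableAt
  have h2 := outputPower_pos (η := η) (inputPower_pos (η := η) hl hu)
  have h3 : DifferentiableAt ℝ (fun u => outputPower η (inputPower η l hl u) / u) u := by
    unfold outputPower
    exact (h1.add ((h1.pow 3).const_mul _)).div differentiableAt_id hu.ne'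
  exact h3.sqrt (by positivity)

/-- The Jacobian determinant of the radial transport. -/
lemma transportScale_mul_eq {u : ℝ} (hu : 0 < u) :
    transportScale η l hl u * (transportScale η l hl u + 2 * deriv (transportScale η l hl) u * u) =
      survivalPoly η l (inputPower η l hl u) / (l ^ 3 / (l ^ 2 + 6 * η ^ 2)) := by
  have hg := (differentiableAt_transportScale (η := η) hl hu).hasDerivAt
  have ht := hasDerivAt_inputPower (η := η) hl hu
  have h1 := (hg.pow 2).mul (hasDerivAt_id u)
  have h2 := ht.add ((ht.pow 3).const_mul (η ^ 2))
  -- The determinant is the derivative of `g² u`, the output power. Through the input power `t` the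
  -- same derivative has a factor `1 + 3η²t²`, which cancels the one in the hazard rate.
  have h3 : (fun u => transportScale η l hl u ^ 2 * u) =ᶠ[nhds u]
      fun u => inputPower η l hl u + η ^ 2 * inputPower η l hl u ^ 3 := by
    filter_upwards [lt_mem_nhds hu] with x hx using transportScale_sq_mul hl hx.le
  have h4 := h1.unique (h2.congr_of_eventuallyEq h3)
  have hq := survivalPoly_pos (η := η) hl (inputPower_pos (η := η) hl hu).le
  simp only [id, Nat.cast_ofNat, Pi.pow_apply] at h4
  have e : transportScale η l hl u *
      (transportScale η l hl u + 2 * deriv (transportScale η l hl) u * u) =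
      2 * transportScale η l hl u ^ (2 - 1) * deriv (transportScale η l hl) u * u +
        transportScale η l hl u ^ 2 * 1 := by
    ring
  have h5 : 0 < 1 + 3 * η ^ 2 * inputPower η l hl u ^ 2 := by positivity
  rw [e, h4]
  field_simp

lemma transportScale_add_pos {u : ℝ} (hu : 0 < u) :
    0 < transportScale η l hl u + 2 * deriv (transportScale η l hl) u * u := by
  have hq := survivalPoly_pos (η := η) hl (inputPower_pos (η := η) hl hu).le
  have h := transportScale_mul_eq (η := η) hl hu
  have h2 : 0 < survivalPoly η l (inputPower η l hl u) / (l ^ 3 / (l ^ 2 + 6 * η ^ 2)) := by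
    positivity
  rw [← h] at h2
  exact pos_of_mul_pos_right h2 (transportScale_nonneg hl u)

lemma log_transportScale_mul {u : ℝ} (hu : 0 < u) :
    Real.log (transportScale η l hl u *
      (transportScale η l hl u + 2 * deriv (transportScale η l hl) u * u)) =
      l * inputPower η l hl u - u - Real.log (l ^ 3 / (l ^ 2 + 6 * η ^ 2)) := by
  have ht := inputPower_pos (η := η) hl hu
  have hq := survivalPoly_pos (η := η) hl ht.le
  have h := hazard_inputPower (η := η) hl u
  rw [hazard_of_nonneg ht.le] at h
  rw [transportScale_mul_eq hl hu, Real.log_div hq.ne' (by positivity)]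
  linarith

/-- Substituting the hazard for the exponential variable gives `κ ∫ (t + 3η²t³) e^{-lt}`, a sum of
two Gamma integrals. -/
lemma lintegral_inputPower :
    ∫⁻ z, ENNReal.ofReal (inputPower η l hl (‖z‖ ^ 2)) ∂(complexGaussian 1) =
      ENNReal.ofReal ((18 * η ^ 2 + l ^ 2) / (l * (6 * η ^ 2 + l ^ 2))) := by
  have hm := (continuous_inputPower (η := η) hl).measurable
  rw [lintegral_norm_sq_complexGaussian (h := fun u => ENNReal.ofReal (inputPower η l hl u))
    (by fun_prop)]
  have himg : hazard η l '' Set.Ioi 0 = Set.Ioi 0 := by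
    ext u
    simp only [Set.mem_image, Set.mem_Ioi]
    constructor
    · rintro ⟨t, ht, rfl⟩
      have := strictMono_hazard (η := η) hl ht
      rwa [hazard_of_nonpos le_rfl] at this
    · intro hu
      exact ⟨inputPower η l hl u, inputPower_pos hl hu, hazard_inputPower hl u⟩
  have hsub := lintegral_image_eq_lintegral_abs_deriv_mul measurableSet_Ioi
    (fun t ht => (hasDerivAt_hazard (η := η) hl ht).hasDerivWithinAt)
    (strictMono_hazard hl).injective.injOn
    (fun u => ENNReal.ofReal (Real.exp (-u)) * ENNReal.ofReal (inputPower η l hl u))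
  rw [himg] at hsub
  rw [hsub]
  set κ := l ^ 3 / (l ^ 2 + 6 * η ^ 2) with hκ
  have hκ0 : 0 < κ := by positivity
  calc _ = ∫⁻ t in Set.Ioi 0, (ENNReal.ofReal κ * ENNReal.ofReal (t ^ 1 * Real.exp (-(l * t))) +
        ENNReal.ofReal (3 * η ^ 2 * κ) * ENNReal.ofReal (t ^ 3 * Real.exp (-(l * t)))) := by
        refine setLIntegral_congr_fun measurableSet_Ioi fun t ht => ?_
        have ht0 : 0 < t := ht
        have hq := survivalPoly_pos (η := η) hl ht0.le
        rw [inputPower_hazard, abs_of_nonneg (by positivity),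
          ← ENNReal.ofReal_mul (by positivity), ← ENNReal.ofReal_mul (by positivity),
          ← ENNReal.ofReal_mul (by positivity), ← ENNReal.ofReal_mul (by positivity),
          ← ENNReal.ofReal_add (by positivity) (by positivity), hazard_of_nonneg ht0.le,
          neg_sub, sub_eq_add_neg, Real.exp_add, Real.exp_log hq]
        congr 1
        field_simp
    _ = _ := by
        rw [lintegral_add_left (by fun_prop), lintegral_const_mul _ (by fun_prop),
          lintegral_const_mul _ (by fun_prop), lintegral_exp_neg_mul_pow 1 hl,
          lintegral_exp_neg_mul_pow 3 hl,
          ← ENNReal.ofReal_mul (by positivity), ← ENNReal.ofReal_mul (by positivity),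
          ← ENNReal.ofReal_add (by positivity) (by positivity)]
        congr 1
        rw [hκ]
        simp [Nat.factorial]
        field_simp
        ring

lemma integrable_inputPower :
    Integrable (fun z : ℂ => inputPower η l hl (‖z‖ ^ 2)) (complexGaussian 1) := by
  have hm := (continuous_inputPower (η := η) hl).measurable
  refine ⟨by fun_prop, ?_⟩
  rw [hasFiniteIntegral_iff_ofReal (ae_of_all _ fun z => inputPower_nonneg hl (by positivity)),
    lintegral_inputPower]
  exact ENNReal.ofReal_lt_top

lemma integral_inputPower : ∫ z : ℂ, inputPower η l hl (‖z‖ ^ 2) ∂(complexGaussian 1) =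
    (18 * η ^ 2 + l ^ 2) / (l * (6 * η ^ 2 + l ^ 2)) := by
  have hm := (continuous_inputPower (η := η) hl).measurable
  rw [integral_eq_lintegral_of_nonneg_ae (ae_of_all _ fun z => inputPower_nonneg hl (by positivity))
    (by fun_prop), lintegral_inputPower, ENNReal.toReal_ofReal (by positivity)]

lemma log_jacobian_ae_eq :
    (fun z : ℂ => Real.log (transportScale η l hl (‖z‖ ^ 2) * (transportScale η l hl (‖z‖ ^ 2) +
      2 * deriv (transportScale η l hl) (‖z‖ ^ 2) * ‖z‖ ^ 2))) =ᵐ[complexGaussian 1]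
      fun z => l * inputPower η l hl (‖z‖ ^ 2) - ‖z‖ ^ 2 -
        Real.log (l ^ 3 / (l ^ 2 + 6 * η ^ 2)) := by
  filter_upwards [ae_complexGaussian_ne_zero] with z hz
  exact log_transportScale_mul hl (by positivity)

lemma integrable_log_jacobian :
    Integrable (fun z : ℂ => Real.log (transportScale η l hl (‖z‖ ^ 2) *
      (transportScale η l hl (‖z‖ ^ 2) + 2 * deriv (transportScale η l hl) (‖z‖ ^ 2) * ‖z‖ ^ 2)))
      (complexGaussian 1) :=
  (integrable_congr (log_jacobian_ae_eq hl)).2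
    ((((integrable_inputPower hl).const_mul l).sub integrable_norm_sq_complexGaussian).sub
      (integrable_const _))

/-- This is the entropy gain `h(w) - h(A) = log M`; the exponent is `l E t - 1`. -/
lemma integral_log_jacobian :
    ∫ z : ℂ, Real.log (transportScale η l hl (‖z‖ ^ 2) * (transportScale η l hl (‖z‖ ^ 2) +
      2 * deriv (transportScale η l hl) (‖z‖ ^ 2) * ‖z‖ ^ 2)) ∂(complexGaussian 1) =
      Real.log ((l ^ 2 + 6 * η ^ 2) / l ^ 3 * Real.exp (12 * η ^ 2 / (l ^ 2 + 6 * η ^ 2))) := by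
  have h1 : Integrable (fun z : ℂ => l * inputPower η l hl (‖z‖ ^ 2)) (complexGaussian 1) :=
    (integrable_inputPower hl).const_mul l
  have h2 : Integrable (fun z : ℂ => l * inputPower η l hl (‖z‖ ^ 2) - ‖z‖ ^ 2)
    (complexGaussian 1) := h1.sub integrable_norm_sq_complexGaussian
  rw [integral_congr_ae (log_jacobian_ae_eq hl), integral_sub h2 (integrable_const _),
    integral_sub h1 integrable_norm_sq_complexGaussian, integral_const_mul, integral_inputPower,
    integral_norm_sq_complexGaussian, Real.log_mul (by positivity) (Real.exp_pos _).ne',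
    Real.log_exp, ← inv_div (l ^ 3), Real.log_inv]
  simp only [integral_const, probReal_univ, one_smul]
  have : l * ((18 * η ^ 2 + l ^ 2) / (l * (6 * η ^ 2 + l ^ 2))) - 1 =
      12 * η ^ 2 / (l ^ 2 + 6 * η ^ 2) := by
    field_simp
    ring
  linarith

end

-- The input law and the rate it achieves

/-- The channel input, as a function of a standard complex Gaussian variable. -/
noncomputable def inputMap (η l : ℝ) (hl : 0 < l) (z : ℂ) : ℂ :=
  radialMap (transportScale η l hl) z / (1 + Complex.I * (η * inputPower η l hl (‖z‖ ^ 2) : ℝ))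

section

variable {η l : ℝ} (hl : 0 < l)

@[fun_prop]
lemma measurable_inputMap : Measurable (inputMap η l hl) := by
  have h1 := (continuous_inputPower (η := η) hl).measurable
  have h2 := measurable_radialMap (measurable_transportScale (η := η) hl)
  unfold inputMap; fun_prop

lemma normSq_one_add_I_mul (x : ℝ) : ‖1 + Complex.I * (x : ℂ)‖ ^ 2 = 1 + x ^ 2 := by
  rw [Complex.sq_norm, Complex.normSq_apply]
  simp
  ring

lemma norm_inputMap_sq (z : ℂ) : ‖inputMap η l hl z‖ ^ 2 = inputPower η l hl (‖z‖ ^ 2) := by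
  rw [inputMap, norm_div, div_pow, normSq_one_add_I_mul, radialMap, norm_smul, mul_pow,
    Real.norm_eq_abs, sq_abs, transportScale_sq_mul hl (by positivity), outputPower]
  field_simp

/-- The channel multiplies `x` by `1 + jη|x|²`, exactly the denominator of `inputMap`. -/
lemma noiseless_inputMap (z : ℂ) :
    noiseless η (inputMap η l hl z) = radialMap (transportScale η l hl) z := by
  have hne : 1 + Complex.I * ((η * inputPower η l hl (‖z‖ ^ 2) : ℝ) : ℂ) ≠ 0 := by
    rw [← norm_ne_zero_iff]
    intro h
    have := normSq_one_add_I_mul (η * inputPower η l hl (‖z‖ ^ 2))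
    rw [h] at this
    nlinarith [sq_nonneg (η * inputPower η l hl (‖z‖ ^ 2))]
  rw [noiseless, norm_inputMap_sq, inputMap]
  field_simp
  push_cast
  ring

lemma lintegral_enorm_sq_inputMap :
    ∫⁻ x, ‖x‖ₑ ^ 2 ∂((complexGaussian 1).map (inputMap η l hl)) =
      ENNReal.ofReal ((18 * η ^ 2 + l ^ 2) / (l * (6 * η ^ 2 + l ^ 2))) := by
  rw [lintegral_map (by fun_prop) (by fun_prop), ← lintegral_inputPower hl]
  refine lintegral_congr fun z => ?_
  rw [← norm_inputMap_sq, ENNReal.ofReal_pow (norm_nonneg _), ofReal_norm]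

end

/-- The weighted form of `log (M + v)` for the weights proportional to `M` and `v`. -/
lemma weighted_log_eq {M v c s : ℝ} (hM : 0 < M) (hv : 0 < v)
    (hc2 : c ^ 2 = M / (M + v)) (hs2 : s ^ 2 = v / (M + v)) :
    c ^ 2 * Real.log M + 2 * (s ^ 2 * Real.log √v - c ^ 2 * Real.log c - s ^ 2 * Real.log s) =
      Real.log (M + v) := by
  have h1 : 2 * Real.log c = Real.log M - Real.log (M + v) := by
    rw [← Real.log_div hM.ne' (by positivity), ← hc2, Real.log_pow]; simp
  have h2 : 2 * Real.log s = Real.log v - Real.log (M + v) := by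
    rw [← Real.log_div hv.ne' (by positivity), ← hs2, Real.log_pow]; simp
  have h3 : 2 * Real.log √v = Real.log v := by rw [Real.log_sqrt hv.le]; ring
  have h4 : c ^ 2 + s ^ 2 = 1 := by rw [hc2, hs2]; field_simp
  linear_combination -c ^ 2 * h1 - s ^ 2 * h2 + s ^ 2 * h3 + Real.log (M + v) * h4

/-- The mutual information achieved by the input law with parameter `l`. -/
theorem objective_le_mutualInfo (η : ℝ) {v l : ℝ} (hv : 0 < v) (hl : 0 < l) :
    ENNReal.ofReal (objective η v l) ≤
      mutualInfo (jointLaw η v ((complexGaussian 1).map (inputMap η l hl))) := by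
  set γ := complexGaussian 1 with hγ
  set μ := γ.map (inputMap η l hl) with hμ
  have : IsProbabilityMeasure μ := Measure.isProbabilityMeasure_map (by fun_prop)
  have hl2 : 0 < Real.log 2 := Real.log_pos (by norm_num)
  rcases mutualInfo_jointLaw (η := η) (μ := μ) hv with h | ⟨hint, h⟩
  · rw [h]; exact le_top
  rw [h, ← ENNReal.ofReal_div_of_pos hl2]
  apply ENNReal.ofReal_le_ofReal
  rw [objective, Real.logb]
  gcongr
  set M := (l ^ 2 + 6 * η ^ 2) / l ^ 3 * Real.exp (12 * η ^ 2 / (l ^ 2 + 6 * η ^ 2)) with hM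
  have hM0 : 0 < M := by positivity
  have hMv : (l ^ 2 + 6 * η ^ 2) / (l ^ 3 * v) * Real.exp (12 * η ^ 2 / (l ^ 2 + 6 * η ^ 2)) + 1 =
      (M + v) / v := by
    rw [hM]; field_simp
  rw [hMv, Real.log_div (by positivity) hv.ne']
  have hlaw : μ.prod (complexGaussian v) =
      (γ.prod γ).map (Prod.map (inputMap η l hl) fun z => ((√v : ℝ) : ℂ) * z) := by
    rw [complexGaussian_eq_map_smul hv, hμ, Measure.map_prod_map _ _ (by fun_prop) (by fun_prop)]
  have hmeas : Measurable fun q : ℂ × ℂ => Real.log (complexGaussianPDF v q.2) -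
      Real.log (outputPDF η v μ (noiseless η q.1 + q.2)).toReal := by fun_prop
  have hmap : Measurable (Prod.map (inputMap η l hl) fun z : ℂ => ((√v : ℝ) : ℂ) * z) := by fun_prop
  have hcomp : ∀ q : ℂ × ℂ, Real.log (complexGaussianPDF v (((√v : ℝ) : ℂ) * q.2)) -
      Real.log (outputPDF η v μ (noiseless η (inputMap η l hl q.1) + ((√v : ℝ) : ℂ) * q.2)).toReal =
      (-Real.log (Real.pi * v) - ‖q.2‖ ^ 2) - Real.log (outputPDF η v μ
        (radialMap (transportScale η l hl) q.1 + √v • q.2)).toReal := by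
    intro q
    rw [log_complexGaussianPDF hv, noiseless_inputMap, norm_mul, mul_pow, Complex.norm_real,
      Real.norm_eq_abs, sq_abs, Real.sq_sqrt hv.le, mul_div_cancel_left₀ _ hv.ne',
      Complex.real_smul]
  rw [hlaw, integrable_map_measure hmeas.aestronglyMeasurable hmap.aemeasurable] at hint
  simp only [Function.comp_def, Prod.map_fst, Prod.map_snd, hcomp] at hint
  rw [hlaw, integral_map hmap.aemeasurable hmeas.aestronglyMeasurable]
  simp only [Prod.map_fst, Prod.map_snd, hcomp]
  have i0 : Integrable (fun q : ℂ × ℂ => ‖q.2‖ ^ 2) (γ.prod γ) :=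
    integrable_norm_sq_complexGaussian.comp_snd γ
  have i1 : Integrable (fun q : ℂ × ℂ => -Real.log (Real.pi * v) - ‖q.2‖ ^ 2) (γ.prod γ) :=
    (integrable_const _).sub i0
  have i2 : Integrable (fun q : ℂ × ℂ => Real.log (outputPDF η v μ
      (radialMap (transportScale η l hl) q.1 + √v • q.2)).toReal) (γ.prod γ) := by
    refine (i1.sub hint).congr (ae_of_all _ fun q => ?_)
    simp
  have e0 : ∫ q : ℂ × ℂ, ‖q.2‖ ^ 2 ∂(γ.prod γ) = 1 := by
    rw [integral_fun_snd (fun z : ℂ => ‖z‖ ^ 2), integral_norm_sq_complexGaussian]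
    simp
  rw [integral_sub i1 i2, integral_sub (integrable_const _) i0, e0]
  -- Weights proportional to the entropy powers `M` and `v` turn the weighted bound into `log (M +
  -- v)`.
  have hc : 0 < √(M / (M + v)) := by positivity
  have hs : 0 < √(v / (M + v)) := by positivity
  have hc2 : √(M / (M + v)) ^ 2 = M / (M + v) := Real.sq_sqrt (by positivity)
  have hs2 : √(v / (M + v)) ^ 2 = v / (M + v) := Real.sq_sqrt (by positivity)
  have key := integral_log_add_le (fun u hu => transportScale_pos (η := η) hl hu)
    (fun u _ => transportScale_nonneg hl u) (monotoneOn_sqrt_mul_transportScale hl)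
    (fun u hu => differentiableAt_transportScale hl hu) (fun u hu => transportScale_add_pos hl hu)
    (measurable_transportScale hl) hc hs (by rw [hc2, hs2]; field_simp) (Real.sqrt_pos.2 hv)
    (measurable_outputPDF (η := η) (v := v) (μ := μ)) (outputPDF_pos hv) (outputPDF_lt_top hv)
    (lintegral_outputPDF hv).le i2 (integrable_log_jacobian hl)
  rw [integral_log_jacobian, ← hM, ← hγ] at key
  have hw := weighted_log_eq hM0 hv hc2 hs2
  have hpi := Real.log_mul Real.pi_pos.ne' hv.ne'
  simp only [integral_const, probReal_univ, one_smul]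
  linarith

theorem objective_le_capacity {η v P l : ℝ} (hv : 0 < v) (hl : l ∈ feasible η P) :
    ENNReal.ofReal (objective η v l) ≤ capacity η v P := by
  have hl0 := hl.1
  refine (objective_le_mutualInfo η hv hl0).trans ?_
  have hprob : IsProbabilityMeasure ((complexGaussian 1).map (inputMap η l hl0)) :=
    Measure.isProbabilityMeasure_map (by fun_prop)
  have hpow : ∫⁻ x, ‖x‖ₑ ^ 2 ∂((complexGaussian 1).map (inputMap η l hl0)) ≤ ENNReal.ofReal P := by
    rw [lintegral_enorm_sq_inputMap]
    exact ENNReal.ofReal_le_ofReal hl.2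
  exact le_iSup₂_of_le _ hprob (le_iSup_of_le hpow le_rfl)

end RPC

-- Conclusion

theorem theorem1 (η P_N P : ℝ) (hPN : 0 < P_N) (hP : 0 < P) :
    ∃ L l₀ : ℝ,
      -- the lower bound is a maximum, attained on the feasible set
      IsGreatest (RPC.objective η P_N '' RPC.feasible η P) L ∧
      -- it bounds the capacity from below
      ENNReal.ofReal L ≤ RPC.capacity η P_N P ∧
      -- the maximizer is `l₀`
      (∀ l : ℝ, (l ∈ RPC.feasible η P ∧ RPC.objective η P_N l = L) ↔ l = l₀) ∧
      -- `l₀` is the unique positive root of the cubic, and for nonzero `η` its unique real root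
      (∀ l : ℝ, (0 < l ∧ RPC.cubic η P l = 0) ↔ l = l₀) ∧
      (η ≠ 0 → ∀ l : ℝ, RPC.cubic η P l = 0 ↔ l = l₀) := by
  obtain ⟨l₀, hl₀, hroot⟩ := RPC.exists_pos_root_cubic η hP
  have hmem : l₀ ∈ RPC.feasible η P := (RPC.mem_feasible_iff hl₀).2 hroot.ge
  -- A feasible point left of the root would make the cubic positive at the root.
  have hge : ∀ l ∈ RPC.feasible η P, l₀ ≤ l := by
    intro l hl
    by_contra! hlt
    exact (RPC.cubic_pos_of_lt hl.1 hlt ((RPC.mem_feasible_iff hl.1).1 hl)).ne' hroot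
  have huniq : ∀ l : ℝ, (0 < l ∧ RPC.cubic η P l = 0) ↔ l = l₀ := by
    refine fun l => ⟨fun ⟨hl, h⟩ => ?_, by rintro rfl; exact ⟨hl₀, hroot⟩⟩
    refine le_antisymm ?_ (hge l ((RPC.mem_feasible_iff hl).2 h.ge))
    by_contra! hlt
    exact (RPC.cubic_pos_of_lt hl₀ hlt hroot.ge).ne' h
  refine ⟨RPC.objective η P_N l₀, l₀, ⟨⟨l₀, hmem, rfl⟩, ?_⟩, RPC.objective_le_capacity hPN hmem,
    fun l => ⟨fun ⟨hl, h⟩ => ?_, by rintro rfl; exact ⟨hmem, rfl⟩⟩, huniq, fun hη l =>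
    ⟨fun h => (huniq l).1 ⟨RPC.pos_of_cubic_eq_zero hP hη h, h⟩, fun h => ((huniq l).2 h).2⟩⟩
  · rintro _ ⟨l, hl, rfl⟩
    rcases (hge l hl).eq_or_lt with rfl | hlt
    · exact le_rfl
    · exact (RPC.objective_lt hPN hl₀ hlt).le
  · by_contra hne
    exact (RPC.objective_lt hPN hl₀ (lt_of_le_of_ne (hge l hl) (Ne.symm hne))).ne h
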